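/- Let $1\le k\le n<m$ be integers. Encode a collision-free configuration of $n$ photons in $m$ modes (a bit string of length $m$ with $n$ ones) by its set of occupied modes, an $n$-element subset of $\{1,\dots,m\}$. Fix an input configuration $t$ and an output configuration $s$ of this kind. For a unitary $U\in\mathsf U(m)$ and an $n$-element set $s'$ let $$p_U(s')=\bigl|\mathrm{Per}(U_{s',t})\bigr|^2$$ be the probability that $n$ single photons entering the interferometer $U$ in the modes $t$ are detected in the modes $s'$; here $U_{s',t}$ is the $n\times n$ submatrix of $U$ with rows $s'$ and columns $t$, and $\mathrm{Per}$ is the permanent. Let $\mathcal L(s)$ be the set of $(n-k)$-element subsets of $s$ (the loss of $k$ photons), for $r\in\mathcal L(s)$ let $\mathcal G(r)$ be the set of $n$-element subsets of $\{1,\dots,m\}$ that contain $r$, and define the interference term $$I_{s,k}(U)=\frac1{N'_k}\sum_{r\in\mathcal L(s)}\ \sum_{s'\in\mathcal G(r),\,s'\ne s}p_U(s'),\qquad N'_k=\Bigl(\tbinom{m-n+k}{k}-1\Bigr)\tbinom nk .$$ Let $p_{unif}=1/\binom mn$, and let $U$ be distributed according to the normalised Haar measure on $\mathsf U(m)$.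 Then for every real $\epsilon>0$ $$\Pr\bigl(|I_{s,k}-p_{unif}|\ge\epsilon\bigr)\le\frac{n\,p_{unif}^2}{\epsilon^2}.$$ -/

import Mathlib

open MeasureTheory

noncomputable section

namespace LinearOptics

/-! ### Haar probability measure on the unitary group -/

/-- The unitary group of `m × m` complex matrices, with its usual topology, is compact. -/
instance unitaryGroup_compactSpace (m : ℕ) : CompactSpace (Matrix.unitaryGroup (Fin m) ℂ) := by
  have hclosed : IsClosed ((Matrix.unitaryGroup (Fin m) ℂ : Set (Matrix (Fin m) (Fin m) ℂ))) := by
    have h : ((Matrix.unitaryGroup (Fin m) ℂ : Set (Matrix (Fin m) (Fin m) ℂ)))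
        = {A | A * star A = 1} := by
      ext A
      exact Matrix.mem_unitaryGroup_iff
    rw [h]
    exact isClosed_eq (continuous_id.mul continuous_star) continuous_const
  have hbox : IsCompact
      (Set.univ.pi fun _ : Fin m => Set.univ.pi fun _ : Fin m => Metric.closedBall (0 : ℂ) 1) :=
    isCompact_univ_pi fun _ => isCompact_univ_pi fun _ => isCompact_closedBall _ _
  refine isCompact_iff_compactSpace.mp (hbox.of_isClosed_subset hclosed ?_)
  intro A hA i _ j _
  simpa using entry_norm_bound_of_unitary hA i j

/-- The Borel σ-algebra on the unitary group. -/
instance unitaryGroup_measurableSpace (m : ℕ) :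
    MeasurableSpace (Matrix.unitaryGroup (Fin m) ℂ) :=
  borel _

instance unitaryGroup_borelSpace (m : ℕ) : BorelSpace (Matrix.unitaryGroup (Fin m) ℂ) :=
  ⟨rfl⟩

/-- The Haar measure of the unitary group `U(m)`, normalised to total mass one. -/
def haarUnitary (m : ℕ) : Measure (Matrix.unitaryGroup (Fin m) ℂ) :=
  Measure.haarMeasure ⊤

instance haarUnitary_isHaarMeasure (m : ℕ) : (haarUnitary m).IsHaarMeasure := by
  unfold haarUnitary
  infer_instance

instance haarUnitary_isProbabilityMeasure (m : ℕ) : IsProbabilityMeasure (haarUnitary m) :=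
  ⟨by
    have h := Measure.haarMeasure_self
      (K₀ := (⊤ : TopologicalSpace.PositiveCompacts (Matrix.unitaryGroup (Fin m) ℂ)))
    simpa [haarUnitary] using h⟩

/-! ### Bit strings, ideal probabilities and interference terms -/

/-- A collision-free configuration of `r` photons in `m` modes, that is, a bit string of length `m`
with exactly `r` ones.  It is encoded by its set of occupied modes. -/
abbrev BitString (m r : ℕ) : Type :=
  {s : Finset (Fin m) // s.card = r}

/-- The `n × n` submatrix of `U` whose rows are the modes occupied in the output `s` and whose
columns are the modes occupied in the input `t`, both in increasing order. -/
def scatteringMatrix {m n : ℕ} (U : Matrix.unitaryGroup (Fin m) ℂ) (t s : BitString m n) :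
    Matrix (Fin n) (Fin n) ℂ :=
  (U : Matrix (Fin m) (Fin m) ℂ).submatrix (s.1.orderEmbOfFin s.2) (t.1.orderEmbOfFin t.2)

/-- The ideal (lossless) probability that `n` single photons, entering the interferometer `U` in
the modes of `t`, are detected in the modes of `s`. -/
def idealProb {m n : ℕ} (U : Matrix.unitaryGroup (Fin m) ℂ) (t s : BitString m n) : ℝ :=
  ‖(scatteringMatrix U t s).permanent‖ ^ 2

/-- The `(n - k)`-photon bit strings obtained from the `n`-photon bit string `s` by the loss of
`k` photons. -/
def lossyStrings {m n : ℕ} (k : ℕ) (s : BitString m n) : Finset (BitString m (n - k)) :=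
  Finset.univ.filter fun r => r.1 ⊆ s.1

/-- The `n`-photon bit strings from which the bit string `r` with fewer photons can result by
photon loss. -/
def parentStrings {m l : ℕ} (n : ℕ) (r : BitString m l) : Finset (BitString m n) :=
  Finset.univ.filter fun s => r.1 ⊆ s.1

/-- The number of summands of the interference term. -/
def interferenceCount (m n k : ℕ) : ℝ :=
  (((m - n + k).choose k : ℝ) - 1) * (n.choose k : ℝ)

/-- The interference term of the `k`-photon-loss recycled probability of the bit string `s`, for
the interferometer `U` and the input `t`. -/
def interference {m n : ℕ} (U : Matrix.unitaryGroup (Fin m) ℂ) (t : BitString m n) (k : ℕ)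
    (s : BitString m n) : ℝ :=
  ∑ r ∈ lossyStrings k s, ∑ s' ∈ (parentStrings n r).erase s,
    idealProb U t s' * (1 / interferenceCount m n k)

/-- The uniform probability on the `n`-photon bit strings of length `m`. -/
def pUnif (m n : ℕ) : ℝ :=
  1 / (m.choose n : ℝ)

end LinearOptics

end

open MeasureTheory

noncomputable section
namespace LinearOptics

/-! ### Invariance of the Haar measure and integration of continuous functions -/

/-! Chebyshev's inequality reduces the claim to E(I - p)² ≤ n p², with p the uniform probability
(`integral_interference_sub_sq_le`). The substance is an upper bound for E[p_U(s) p_U(s')].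

Two permanents taken over the same columns multiply to a contraction of a tensor B with the vectors
v ⊗ v, where v runs over the n input columns. Only the part of B symmetric under the swap in each
position matters. The columns are removed one at a time: given l other columns, the last is uniform
on the unit sphere of a space of dimension d = m - l. The mean of |v^T Q v|² there is at most the
squared Hilbert–Schmidt norm of Q divided by d(d+1)/2, the dimension of the symmetric square.
Iteration (`prod_mul_integral_contraction_le`) leaves ‖B‖² over a product of such dimensions.

The norm ‖B‖² is a count of permutations (`sum_symTensor_sq_le`), which is halved when s ≠ s'. In
the double sum for E I² equal output strings are a fraction at most 1/(n(m-n)) of all pairs, whence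
E I² ≤ p²(n+1)/2 for n ≥ 2. For n ≥ 3 this suffices even if the nonnegative mean of I is discarded;
for n = 1 and n = 2 the mean is computed exactly. -/

instance haarUnitary_isMulRightInvariant (m : ℕ) : (haarUnitary m).IsMulRightInvariant := by
  refine ⟨fun g => ?_⟩
  -- Right translation is an action of the opposite group commuting with left translation, so the
  -- pushforward is again a left Haar probability measure, and uniqueness applies.
  have h : Measure.map (· * g) (haarUnitary m)
      = Measure.map (MulOpposite.op g • ·) (haarUnitary m) := rfl
  rw [h]
  have : IsProbabilityMeasure (Measure.map (MulOpposite.op g • ·) (haarUnitary m)) :=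
    Measure.isProbabilityMeasure_map (measurable_mul_const g).aemeasurable
  exact Measure.isHaarMeasure_eq_of_isProbabilityMeasure _ _

theorem integrable_haarUnitary {m : ℕ} {f : Matrix.unitaryGroup (Fin m) ℂ → ℝ}
    (hf : Continuous f) : Integrable f (haarUnitary m) :=
  hf.integrable_of_hasCompactSupport (HasCompactSupport.of_compactSpace f)

@[fun_prop]
theorem continuous_unitary_apply {m : ℕ} (i j : Fin m) :
    Continuous fun U : Matrix.unitaryGroup (Fin m) ℂ => U.1 i j :=
  (continuous_apply j).comp ((continuous_apply i).comp continuous_subtype_val)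

/-- A unit vector supported away from a set of coordinates is a column of a unitary matrix which
fixes these coordinates. -/
theorem exists_unitary_column {m : ℕ} (P : Finset (Fin m)) {j : Fin m} (hj : j ∉ P)
    (w : Fin m → ℂ) (hw : ∀ i ∈ P, w i = 0) (hn : ∑ i, ‖w i‖ ^ 2 = 1) :
    ∃ D : Matrix.unitaryGroup (Fin m) ℂ,
      (∀ i ∈ P, ∀ a, D.1 a i = if a = i then 1 else 0) ∧ ∀ a, D.1 a j = w a := by
  classical
  let v : Fin m → EuclideanSpace ℂ (Fin m) := fun i =>
    if i = j then WithLp.toLp 2 w else EuclideanSpace.single i 1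
  have hv : Orthonormal ℂ ((insert j (P : Set (Fin m))).domRestrict v) := by
    rw [orthonormal_iff_ite]
    rintro ⟨a, ha⟩ ⟨b, hb⟩
    have hnorm : inner ℂ (WithLp.toLp 2 w : EuclideanSpace ℂ (Fin m)) (WithLp.toLp 2 w) = 1 := by
      have hw1 : ‖(WithLp.toLp 2 w : EuclideanSpace ℂ (Fin m))‖ ^ 2 = 1 := by
        rw [EuclideanSpace.norm_sq_eq]
        exact hn
      rw [inner_self_eq_norm_sq_to_K, ← RCLike.ofReal_pow, hw1, RCLike.ofReal_one]
    have hP : ∀ c, c ∈ insert j (P : Set (Fin m)) → c ≠ j → w c = 0 := by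
      intro c hc hcj
      exact hw c (by simpa [hcj] using hc)
    have e : ∀ c hc, (insert j (P : Set (Fin m))).domRestrict v ⟨c, hc⟩ = v c := fun _ _ => rfl
    rw [e, e]
    by_cases h1 : a = j <;> by_cases h2 : b = j
    · subst h1; subst h2
      simpa [v] using hnorm
    · subst h1
      simp [v, h2, Ne.symm h2, EuclideanSpace.inner_single_right, hP b hb h2]
    · subst h2
      simp [v, h1, EuclideanSpace.inner_single_left, hP a ha h1]
    · simp [v, h1, h2, EuclideanSpace.inner_single_left]
  obtain ⟨b, hb⟩ := hv.exists_orthonormalBasis_extension_of_card_eq (by simp)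
  refine ⟨⟨Matrix.of fun a i => b i a, ?_⟩, ?_, ?_⟩
  · rw [Matrix.mem_unitaryGroup_iff']
    ext i k
    have := orthonormal_iff_ite.1 b.orthonormal i k
    rw [PiLp.inner_apply] at this
    rw [Matrix.mul_apply, Matrix.one_apply, ← this]
    refine Finset.sum_congr rfl fun a _ => ?_
    simp [Matrix.star_apply, mul_comm]
  · intro i hi a
    have hij : i ≠ j := fun h => hj (h ▸ hi)
    have : b i = v i := hb i (by simp [hi])
    simp [this, v, hij]
  · intro a
    have : b j = v j := hb j (by simp)
    simp [this, v]

/-! ### The symmetric square of a unitarily invariant quadratic form -/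

/-- Summing over the fourth roots of unity ω kills every cross term, since these carry ω or ω² up to
conjugation; the signs ±1 alone would leave the one between x and y. -/
theorem sum_norm_sq_rotate (x y z : ℂ) :
    ‖(x + 2 * 1 * z + 1 ^ 2 * y) / 2‖ ^ 2 + ‖(x + 2 * (-1) * z + (-1) ^ 2 * y) / 2‖ ^ 2
      + ‖(x + 2 * Complex.I * z + Complex.I ^ 2 * y) / 2‖ ^ 2
      + ‖(x + 2 * (-Complex.I) * z + (-Complex.I) ^ 2 * y) / 2‖ ^ 2
      = ‖x‖ ^ 2 + ‖y‖ ^ 2 + 4 * ‖z‖ ^ 2 := by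
  simp only [← Complex.normSq_eq_norm_sq, Complex.normSq_div, neg_sq, Complex.I_sq, one_pow]
  simp [Complex.normSq_apply]
  ring

section

variable {m : ℕ} {α : Type*} [Fintype α]
  {K : α → Matrix.unitaryGroup (Fin m) ℂ → Matrix (Fin m) (Fin m) ℂ} {W : Finset (Fin m)} {M : ℝ}

theorem integral_diag_of_invariant
    (hM : ∀ w : Fin m → ℂ, (∀ i ∉ W, w i = 0) → ∑ i, ‖w i‖ ^ 2 = 1 →
      ∫ U, ∑ x, ‖w ⬝ᵥ (K x U).mulVec w‖ ^ 2 ∂haarUnitary m = M) {i : Fin m} (hi : i ∈ W) :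
    ∫ U, ∑ x, ‖K x U i i‖ ^ 2 ∂haarUnitary m = M := by
  rw [← hM (Pi.single i 1) (fun j hj => by
    rw [Pi.single_eq_of_ne]; rintro rfl; exact hj hi) (by
    rw [Finset.sum_eq_single i] <;> simp +contextual)]
  simp

/-- Polarisation: evaluate the form at (e_i + ω e_j)/√2 for the four ω with ω⁴ = 1 and add. The
diagonal entries each have mean M, so 4M = M + M + 4E, with E the mean sought. -/
theorem integral_offDiag_of_invariant
    (hc : ∀ x i j, Continuous fun U => K x U i j) (hs : ∀ x U i j, K x U i j = K x U j i)
    (hM : ∀ w : Fin m → ℂ, (∀ i ∉ W, w i = 0) → ∑ i, ‖w i‖ ^ 2 = 1 →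
      ∫ U, ∑ x, ‖w ⬝ᵥ (K x U).mulVec w‖ ^ 2 ∂haarUnitary m = M)
    {i j : Fin m} (hi : i ∈ W) (hj : j ∈ W) (hij : i ≠ j) :
    ∫ U, ∑ x, ‖K x U i j‖ ^ 2 ∂haarUnitary m = M / 2 := by
  have hsq : ((Real.sqrt 2 : ℂ))⁻¹ * ((Real.sqrt 2 : ℂ))⁻¹ = 1 / 2 := by
    rw [← mul_inv, ← Complex.ofReal_mul, Real.mul_self_sqrt (by norm_num)]
    norm_num
  have key : ∀ ω : ℂ, ‖ω‖ = 1 → ∫ U, ∑ x, ‖(K x U i i + 2 * ω * K x U i j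
      + ω ^ 2 * K x U j j) / 2‖ ^ 2 ∂haarUnitary m = M := by
    intro ω hω
    rw [← hM (Pi.single i (Real.sqrt 2 : ℂ)⁻¹ + Pi.single j ((Real.sqrt 2 : ℂ)⁻¹ * ω))]
    · refine integral_congr_ae (Filter.Eventually.of_forall fun U => ?_)
      refine Finset.sum_congr rfl fun x _ => ?_
      congr 2
      simp only [Matrix.mulVec_add, add_dotProduct, dotProduct_add, single_dotProduct,
        Matrix.mulVec_single, Pi.smul_apply, Matrix.col_apply, MulOpposite.smul_eq_mul_unop,
        MulOpposite.unop_op]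
      rw [hs x U j i]
      linear_combination (K x U i i + 2 * ω * K x U i j + ω ^ 2 * K x U j j) * (-hsq)
    · intro k hk
      have h1 : k ≠ i := by rintro rfl; exact hk hi
      have h2 : k ≠ j := by rintro rfl; exact hk hj
      simp [h1, h2]
    · rw [Finset.sum_eq_add_of_mem i j (Finset.mem_univ _) (Finset.mem_univ _) hij]
      · simp [hij, hij.symm, hω, abs_of_nonneg (Real.sqrt_nonneg 2)]
        norm_num
      · intro k _ hk
        simp [hk.1, hk.2]
  have hint : ∀ ω : ℂ, Integrable (fun U => ∑ x, ‖(K x U i i + 2 * ω * K x U i j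
      + ω ^ 2 * K x U j j) / 2‖ ^ 2) (haarUnitary m) := by
    intro ω
    have := hc
    exact integrable_haarUnitary (by fun_prop)
  have hint' : ∀ a b, Integrable (fun U => ∑ x, ‖K x U a b‖ ^ 2) (haarUnitary m) := by
    intro a b
    have := hc
    exact integrable_haarUnitary (by fun_prop)
  have k1 := key 1 (by simp)
  have k2 := key (-1) (by simp)
  have k3 := key Complex.I (by simp)
  have k4 := key (-Complex.I) (by simp)
  have d1 := integral_diag_of_invariant hM hi
  have d2 := integral_diag_of_invariant hM hj
  have total : ∫ U, ((∑ x, ‖(K x U i i + 2 * 1 * K x U i j + 1 ^ 2 * K x U j j) / 2‖ ^ 2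
      + ∑ x, ‖(K x U i i + 2 * (-1) * K x U i j + (-1) ^ 2 * K x U j j) / 2‖ ^ 2
      + ∑ x, ‖(K x U i i + 2 * Complex.I * K x U i j + Complex.I ^ 2 * K x U j j) / 2‖ ^ 2)
      + ∑ x, ‖(K x U i i + 2 * (-Complex.I) * K x U i j + (-Complex.I) ^ 2 * K x U j j) / 2‖ ^ 2)
        ∂haarUnitary m
      = ∫ U, (∑ x, ‖K x U i i‖ ^ 2 + ∑ x, ‖K x U j j‖ ^ 2 + 4 * ∑ x, ‖K x U i j‖ ^ 2)
        ∂haarUnitary m := by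
    refine integral_congr_ae (Filter.Eventually.of_forall fun U => ?_)
    simp only [Finset.mul_sum, ← Finset.sum_add_distrib]
    exact Finset.sum_congr rfl fun x _ => sum_norm_sq_rotate _ _ _
  rw [integral_add (((hint _).fun_add (hint _)).fun_add (hint _)) (hint _),
    integral_add ((hint _).fun_add (hint _)) (hint _), integral_add (hint _) (hint _),
    integral_add ((hint' _ _).fun_add (hint' _ _)) ((hint' _ _).const_mul _),
    integral_add (hint' _ _) (hint' _ _), integral_const_mul, k1, k2, k3, k4, d1, d2] at total
  linarith

/-- A quadratic form with constant mean on the unit sphere of a coordinate subspace has mean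
Hilbert–Schmidt norm at least that constant times the dimension of the symmetric square. -/
theorem card_symSq_mul_le_integral
    (hc : ∀ x i j, Continuous fun U => K x U i j) (hs : ∀ x U i j, K x U i j = K x U j i)
    (hM : ∀ w : Fin m → ℂ, (∀ i ∉ W, w i = 0) → ∑ i, ‖w i‖ ^ 2 = 1 →
      ∫ U, ∑ x, ‖w ⬝ᵥ (K x U).mulVec w‖ ^ 2 ∂haarUnitary m = M) :
    (W.card * (W.card + 1) / 2 : ℝ) * M
      ≤ ∫ U, ∑ x, ∑ i, ∑ j, ‖K x U i j‖ ^ 2 ∂haarUnitary m := by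
  have hint : ∀ a b, Integrable (fun U => ∑ x, ‖K x U a b‖ ^ 2) (haarUnitary m) := by
    intro a b
    have := hc
    exact integrable_haarUnitary (by fun_prop)
  calc (W.card * (W.card + 1) / 2 : ℝ) * M
      = ∑ i ∈ W, ∑ j ∈ W, if i = j then M else M / 2 := by
        have : ∀ i ∈ W, ∑ j ∈ W, (if i = j then M else M / 2) = M / 2 + W.card * (M / 2) := by
          intro i hi
          have : ∀ j, (if i = j then M else M / 2) = (if i = j then M / 2 else 0) + M / 2 := by
            intro j; split_ifs <;> ring
          simp only [this, Finset.sum_add_distrib, Finset.sum_ite_eq, hi, if_true,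
            Finset.sum_const, nsmul_eq_mul]
        rw [Finset.sum_congr rfl this, Finset.sum_const, nsmul_eq_mul]
        ring
    _ = ∑ i ∈ W, ∑ j ∈ W, ∫ U, ∑ x, ‖K x U i j‖ ^ 2 ∂haarUnitary m := by
        refine Finset.sum_congr rfl fun i hi => Finset.sum_congr rfl fun j hj => ?_
        split_ifs with h
        · subst h; exact (integral_diag_of_invariant hM hi).symm
        · exact (integral_offDiag_of_invariant hc hs hM hi hj h).symm
    -- The only loss: entries with an index outside `W` are added.
    _ ≤ ∑ i, ∑ j, ∫ U, ∑ x, ‖K x U i j‖ ^ 2 ∂haarUnitary m := by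
        have h0 : ∀ i j, 0 ≤ ∫ U, ∑ x, ‖K x U i j‖ ^ 2 ∂haarUnitary m := fun i j =>
          integral_nonneg fun U => by positivity
        refine (Finset.sum_le_sum fun i _ => Finset.sum_le_univ_sum_of_nonneg (h0 i)).trans ?_
        exact Finset.sum_le_univ_sum_of_nonneg fun i => Finset.sum_nonneg fun j _ => h0 i j
    _ = _ := by
        simp_rw [Finset.sum_comm (f := fun x i => ∑ j, ‖K x _ i j‖ ^ 2)]
        rw [integral_finsetSum _ fun i _ => ?_]
        · refine Finset.sum_congr rfl fun i _ => ?_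
          simp_rw [Finset.sum_comm (f := fun x j => ‖K x _ i j‖ ^ 2)]
          rw [integral_finsetSum _ fun j _ => hint i j]
        · have := hc
          exact integrable_haarUnitary (by fun_prop)

end

/-! ### Moments of products of columns -/

theorem sum_norm_sq_eq_trace {m : ℕ} (A : Matrix (Fin m) (Fin m) ℂ) :
    ((∑ i, ∑ j, ‖A i j‖ ^ 2 : ℝ) : ℂ) = (A.conjTranspose * A).trace := by
  rw [Finset.sum_comm]
  simp [Matrix.trace, Matrix.mul_apply, Complex.conj_mul']

theorem sum_norm_sq_unitary_conj {m : ℕ} (U : Matrix.unitaryGroup (Fin m) ℂ)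
    (A : Matrix (Fin m) (Fin m) ℂ) :
    ∑ i, ∑ j, ‖(U.1.transpose * A * U.1) i j‖ ^ 2 = ∑ i, ∑ j, ‖A i j‖ ^ 2 := by
  have h1 : U.1 * U.1.conjTranspose = 1 := Matrix.mem_unitaryGroup_iff.1 U.2
  have h2 : U.1.transpose.conjTranspose * U.1.transpose = 1 := by
    have := congrArg Matrix.transpose h1
    rwa [Matrix.transpose_mul, Matrix.transpose_one] at this
  apply Complex.ofReal_injective
  rw [sum_norm_sq_eq_trace, sum_norm_sq_eq_trace]
  calc ((U.1.transpose * A * U.1).conjTranspose * (U.1.transpose * A * U.1)).trace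
      = (U.1.conjTranspose * (A.conjTranspose * (U.1.transpose.conjTranspose * U.1.transpose)
          * A * U.1)).trace := by
        simp only [Matrix.conjTranspose_mul, Matrix.mul_assoc]
    _ = (A.conjTranspose * A * (U.1 * U.1.conjTranspose)).trace := by
        rw [h2, Matrix.mul_one, Matrix.trace_mul_comm, Matrix.mul_assoc (A.conjTranspose * A)]
    _ = _ := by rw [h1, Matrix.mul_one]

/-- The entry of the tensor square of the column `j` of `U`. -/
def colPair {m : ℕ} (U : Matrix.unitaryGroup (Fin m) ℂ) (j : Fin m) (c : Fin m × Fin m) : ℂ :=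
  U.1 c.1 j * U.1 c.2 j

@[fun_prop]
theorem continuous_colPair {m : ℕ} (j : Fin m) (c : Fin m × Fin m) :
    Continuous fun U => colPair U j c := by
  unfold colPair
  fun_prop

theorem sum_snoc {m l : ℕ} {R : Type*} [AddCommMonoid R] (f : (Fin (l + 1) → Fin m × Fin m) → R) :
    ∑ c, f c = ∑ i, ∑ c : Fin l → Fin m × Fin m, f (Fin.snoc (α := fun _ => Fin m × Fin m) c i) := by
  rw [← Fintype.sum_prod_type',
    ← (Fin.snocEquiv fun _ : Fin (l + 1) => Fin m × Fin m).sum_comp]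
  rfl

/-- The last position of a tensor, contracted with columns of `U` in all the other positions. -/
def lastForm {m l : ℕ} (B : (Fin (l + 1) → Fin m × Fin m) → ℂ) (t : Fin l → Fin m)
    (U : Matrix.unitaryGroup (Fin m) ℂ) : Matrix (Fin m) (Fin m) ℂ :=
  Matrix.of fun a b => ∑ c : Fin l → Fin m × Fin m,
    B (Fin.snoc (α := fun _ => Fin m × Fin m) c (a, b)) * ∏ p, colPair U (t p) (c p)

theorem continuous_lastForm {m l : ℕ} (B : (Fin (l + 1) → Fin m × Fin m) → ℂ)
    (t : Fin l → Fin m) (a b : Fin m) : Continuous fun U => lastForm B t U a b := by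
  simp only [lastForm, Matrix.of_apply]
  fun_prop

/-- Removal of one column. Right multiplication by a unitary `D` that fixes the first l chosen
columns turns the last one into U w, with w any unit vector supported off their indices. Hence the
form U^T Q U, where Q depends only on the first l columns, has the same mean at all such w, a sphere
in dimension m - l. Its Hilbert–Schmidt norm is that of Q, and the entries of Q are contractions
with l columns. -/
theorem card_symSq_mul_integral_succ_le {m l : ℕ} {α : Type*} [Fintype α] (t : Fin (l + 1) → Fin m)
    (ht : Function.Injective t) (B : α → (Fin (l + 1) → Fin m × Fin m) → ℂ)
    (hB : ∀ x c a b, B x (Fin.snoc (α := fun _ => Fin m × Fin m) c (a, b))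
      = B x (Fin.snoc (α := fun _ => Fin m × Fin m) c (b, a))) :
    (((m : ℝ) - l) * (m - l + 1) / 2)
        * ∫ U, ∑ x, ‖∑ c, B x c * ∏ p, colPair U (t p) (c p)‖ ^ 2 ∂haarUnitary m
      ≤ ∫ U, ∑ y : α × (Fin m × Fin m), ‖∑ c : Fin l → Fin m × Fin m,
          B y.1 (Fin.snoc (α := fun _ => Fin m × Fin m) c y.2)
            * ∏ p : Fin l, colPair U (t p.castSucc) (c p)‖ ^ 2 ∂haarUnitary m := by
  classical
  set P : Finset (Fin m) := Finset.univ.image fun p : Fin l => t p.castSucc with hP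
  have hPc : P.card = l := by
    rw [hP, Finset.card_image_of_injective _
      (fun a b h => Fin.castSucc_injective l (ht h))]
    simp
  have hlm : l ≤ m := by
    rw [← hPc]
    simpa using Finset.card_le_univ P
  have hj : t (Fin.last l) ∉ P := by
    simp only [hP, Finset.mem_image, Finset.mem_univ, true_and, not_exists]
    intro p hp
    exact (Fin.castSucc_lt_last p).ne (ht hp)
  have hq : ∀ x U a b, lastForm (B x) (fun p => t p.castSucc) U a b
      = lastForm (B x) (fun p => t p.castSucc) U b a := by
    intro x U a b
    simp only [lastForm, Matrix.of_apply, hB x _ a b]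
  have hsplit : ∀ x (U : Matrix.unitaryGroup (Fin m) ℂ), ∑ c, B x c * ∏ p, colPair U (t p) (c p)
      = (fun a => U.1 a (t (Fin.last l))) ⬝ᵥ (lastForm (B x) (fun p => t p.castSucc) U).mulVec
        (fun a => U.1 a (t (Fin.last l))) := by
    intro x U
    rw [sum_snoc, Fintype.sum_prod_type]
    simp only [dotProduct, Matrix.mulVec, lastForm, Matrix.of_apply, Finset.mul_sum,
      Finset.sum_mul]
    refine Finset.sum_congr rfl fun a _ => Finset.sum_congr rfl fun b _ =>
      Finset.sum_congr rfl fun c _ => ?_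
    rw [Fin.prod_univ_castSucc]
    simp only [Fin.snoc_castSucc, Fin.snoc_last, colPair]
    ring
  have main := card_symSq_mul_le_integral (m := m) (W := Pᶜ)
    (M := ∫ U, ∑ x, ‖∑ c, B x c * ∏ p, colPair U (t p) (c p)‖ ^ 2 ∂haarUnitary m)
    (K := fun x U => U.1.transpose * lastForm (B x) (fun p => t p.castSucc) U * U.1)
    (by
      intro x i j
      have := continuous_lastForm (B x) fun p => t p.castSucc
      simp only [Matrix.mul_apply, Matrix.transpose_apply]
      fun_prop)
    (by
      intro x U i j
      have hT : (lastForm (B x) (fun p => t p.castSucc) U).transpose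
          = lastForm (B x) (fun p => t p.castSucc) U := by
        ext a b
        exact hq x U b a
      rw [← Matrix.transpose_apply (U.1.transpose * _ * U.1)]
      rw [Matrix.transpose_mul, Matrix.transpose_mul, Matrix.transpose_transpose, hT,
        Matrix.mul_assoc])
    (by
      intro w hw hn
      obtain ⟨D, hD1, hD2⟩ := exists_unitary_column P hj w
        (fun i hi => hw i (by simpa using hi)) hn
      have hfix : ∀ (U : Matrix.unitaryGroup (Fin m) ℂ) (p : Fin l) a,
          (U * D).1 a (t p.castSucc) = U.1 a (t p.castSucc) := by
        intro U p a
        have hp : t p.castSucc ∈ P := Finset.mem_image_of_mem _ (Finset.mem_univ p)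
        rw [Submonoid.coe_mul, Matrix.mul_apply]
        simp [hD1 _ hp]
      have hlast : ∀ (U : Matrix.unitaryGroup (Fin m) ℂ),
          (fun a => (U * D).1 a (t (Fin.last l))) = U.1.mulVec w := by
        intro U
        ext a
        rw [Submonoid.coe_mul, Matrix.mul_apply]
        simp [hD2, Matrix.mulVec, dotProduct]
      rw [← integral_mul_right_eq_self (μ := haarUnitary m)
        (fun U => ∑ x, ‖∑ c, B x c * ∏ p, colPair U (t p) (c p)‖ ^ 2) D]
      refine integral_congr_ae (Filter.Eventually.of_forall fun U => ?_)
      refine Finset.sum_congr rfl fun x _ => ?_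
      rw [hsplit, hlast]
      have hform : lastForm (B x) (fun p => t p.castSucc) (U * D)
          = lastForm (B x) (fun p => t p.castSucc) U := by
        ext a b
        simp only [lastForm, Matrix.of_apply, colPair, hfix]
      rw [hform, Matrix.mul_assoc, ← Matrix.mulVec_mulVec, Matrix.dotProduct_mulVec,
        Matrix.vecMul_transpose, Matrix.mulVec_mulVec])
  have hcard : ((Pᶜ.card : ℕ) : ℝ) = m - l := by
    rw [Finset.card_compl, hPc, Fintype.card_fin, Nat.cast_sub hlm]
  rw [hcard] at main
  refine main.trans (le_of_eq ?_)
  refine integral_congr_ae (Filter.Eventually.of_forall fun U => ?_)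
  simp only [sum_norm_sq_unitary_conj]
  rw [Fintype.sum_prod_type]
  refine Finset.sum_congr rfl fun x _ => ?_
  rw [Fintype.sum_prod_type]
  rfl

/-- The mean square of the contraction of a symmetric tensor with orthonormal columns is bounded by
its squared norm divided by dimensions of symmetric squares. -/
theorem prod_mul_integral_contraction_le {m : ℕ} (l : ℕ) : ∀ {α : Type} [Fintype α]
    (t : Fin l → Fin m) (_ : Function.Injective t) (B : α → (Fin l → Fin m × Fin m) → ℂ)
    (_ : ∀ x c c', (∀ p, c' p = c p ∨ c' p = (c p).swap) → B x c' = B x c),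
    (∏ p : Fin l, ((m : ℝ) - (p : ℕ)) * (m - (p : ℕ) + 1) / 2)
        * ∫ U, ∑ x, ‖∑ c, B x c * ∏ p, colPair U (t p) (c p)‖ ^ 2 ∂haarUnitary m
      ≤ ∑ x, ∑ c, ‖B x c‖ ^ 2 := by
  induction l with
  | zero =>
    intro α _ t _ B _
    simp
  | succ l ih =>
    intro α _ t ht B hB
    have hlm : l + 1 ≤ m := by simpa using Fintype.card_le_of_injective t ht
    -- The freed pair of indices joins the outer summation index; this is why the induction is over
    -- families of tensors.
    have h1 := ih (α := α × (Fin m × Fin m)) (fun p => t p.castSucc)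
      (ht.comp (Fin.castSucc_injective l))
      (fun y c => B y.1 (Fin.snoc (α := fun _ => Fin m × Fin m) c y.2)) (by
        intro y c c' h
        refine hB _ _ _ fun p => ?_
        refine Fin.lastCases ?_ (fun p => ?_) p
        · simp
        · simpa using h p)
    have h2 := card_symSq_mul_integral_succ_le t ht B (by
      intro x c a b
      refine hB _ _ _ fun p => ?_
      refine Fin.lastCases ?_ (fun p => ?_) p <;> simp)
    rw [Fin.prod_univ_castSucc, mul_assoc]
    refine (mul_le_mul_of_nonneg_left h2 ?_).trans (h1.trans (le_of_eq ?_))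
    · refine Finset.prod_nonneg fun p _ => ?_
      have : ((p : ℕ) : ℝ) ≤ m := by exact_mod_cast (p.2.le.trans (Nat.le_of_succ_le hlm))
      have : (0 : ℝ) ≤ m - (p : ℕ) := by linarith
      simp only [Fin.val_castSucc]
      positivity
    · rw [Fintype.sum_prod_type]
      exact Finset.sum_congr rfl fun x _ => (sum_snoc fun c => ‖B x c‖ ^ 2).symm

/-! ### The symmetrised tensor of a product of two permanents -/

/-- Swap the two entries of `c` at the positions in `S`. -/
def swapOn {n : ℕ} {β : Type*} (S : Finset (Fin n)) (c : Fin n → β × β) : Fin n → β × β :=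
  fun p => if p ∈ S then (c p).swap else c p

theorem swapOn_swapOn {n : ℕ} {β : Type*} (S T : Finset (Fin n)) (c : Fin n → β × β) :
    swapOn S (swapOn T c) = swapOn (symmDiff S T) c := by
  funext p
  by_cases h1 : p ∈ S <;> by_cases h2 : p ∈ T <;> simp [swapOn, h1, h2, Finset.mem_symmDiff]

theorem swapOn_involutive {n : ℕ} {β : Type*} (S : Finset (Fin n)) :
    Function.Involutive (swapOn S : (Fin n → β × β) → Fin n → β × β) := by
  intro c
  rw [swapOn_swapOn, symmDiff_self]
  funext p
  simp [swapOn]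

section

variable {m n : ℕ} (g h : Fin n → Fin m)

/-- The number of ways to write `c` as a pair of orderings of the rows `g` and `h`. -/
def pairTensor (c : Fin n → Fin m × Fin m) : ℝ :=
  ∑ σ : Equiv.Perm (Fin n), ∑ τ : Equiv.Perm (Fin n),
    if c = fun p => (g (σ p), h (τ p)) then 1 else 0

/-- The symmetrisation of `pairTensor` over the swaps at all positions. -/
def symTensor (c : Fin n → Fin m × Fin m) : ℝ :=
  (1 / 2 ^ n) * ∑ S : Finset (Fin n), pairTensor g h (swapOn S c)

theorem symTensor_swapOn (T : Finset (Fin n)) (c : Fin n → Fin m × Fin m) :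
    symTensor g h (swapOn T c) = symTensor g h c := by
  unfold symTensor
  congr 1
  have hinv : Function.Involutive fun S : Finset (Fin n) => symmDiff S T := fun S =>
    symmDiff_symmDiff_cancel_right T S
  rw [← Equiv.sum_comp hinv.toPerm fun S => pairTensor g h (swapOn S c)]
  simp [swapOn_swapOn]

theorem sum_pairTensor_mul {R : Type*} [CommSemiring R] [Algebra ℝ R]
    (F : (Fin n → Fin m × Fin m) → R) :
    ∑ c, algebraMap ℝ R (pairTensor g h c) * F c
      = ∑ σ : Equiv.Perm (Fin n), ∑ τ : Equiv.Perm (Fin n), F fun p => (g (σ p), h (τ p)) := by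
  simp only [pairTensor, map_sum, Finset.sum_mul]
  rw [Finset.sum_comm]
  refine Finset.sum_congr rfl fun σ _ => ?_
  rw [Finset.sum_comm]
  refine Finset.sum_congr rfl fun τ _ => ?_
  rw [Finset.sum_eq_single fun p => (g (σ p), h (τ p))]
  · simp
  · intro c _ hc
    simp [hc]
  · simp

/-- A swap-invariant F cannot see the symmetrisation. The case R = ℂ serves the product of
permanents; R = ℝ with F = `symTensor g h` serves the squared norm. -/
theorem sum_symTensor_mul {R : Type*} [CommRing R] [Algebra ℝ R]
    (F : (Fin n → Fin m × Fin m) → R) (hF : ∀ S c, F (swapOn S c) = F c) :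
    ∑ c, algebraMap ℝ R (symTensor g h c) * F c
      = ∑ σ : Equiv.Perm (Fin n), ∑ τ : Equiv.Perm (Fin n), F fun p => (g (σ p), h (τ p)) := by
  have h1 : ∀ S : Finset (Fin n), ∑ c, algebraMap ℝ R (pairTensor g h (swapOn S c)) * F c
      = ∑ c, algebraMap ℝ R (pairTensor g h c) * F c := by
    intro S
    rw [← Equiv.sum_comp (swapOn_involutive S).toPerm
      fun c => algebraMap ℝ R (pairTensor g h c) * F c]
    simp [hF]
  simp only [symTensor, map_mul, map_sum, mul_assoc, Finset.sum_mul]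
  rw [← Finset.mul_sum, Finset.sum_comm, Finset.sum_congr rfl fun S _ => h1 S, Finset.sum_const,
    ← sum_pairTensor_mul g h F, Finset.card_univ, Fintype.card_finset, Fintype.card_fin,
    nsmul_eq_mul, ← mul_assoc]
  have : algebraMap ℝ R (1 / 2 ^ n) * ((2 ^ n : ℕ) : R) = 1 := by
    have h2 : (1 / 2 ^ n : ℝ) * ((2 ^ n : ℕ) : ℝ) = 1 := by
      push_cast
      field_simp
    rw [← map_natCast (algebraMap ℝ R), ← map_mul, h2, map_one]
  rw [this, one_mul]

theorem sum_symTensor_sq :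
    ∑ c, symTensor g h c ^ 2 = (1 / 2 ^ n) * ∑ σ : Equiv.Perm (Fin n), ∑ τ : Equiv.Perm (Fin n),
      ∑ S : Finset (Fin n), pairTensor g h (swapOn S fun p => (g (σ p), h (τ p))) := by
  have := sum_symTensor_mul g h (R := ℝ) (symTensor g h) (symTensor_swapOn g h)
  simp only [Algebra.algebraMap_self, RingHom.id_apply, ← sq] at this
  rw [this]
  simp only [symTensor, Finset.mul_sum]

variable {g h}

/-- Off S the first components force σ = σ', so σ and σ' have the same image of S; on S the swapped
component gives h ∘ τ = g ∘ σ'. -/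
theorem image_eq_of_swapOn_eq (hg : Function.Injective g) {S : Finset (Fin n)}
    {σ τ σ' τ' : Equiv.Perm (Fin n)}
    (H : (swapOn S fun p => (g (σ p), h (τ p))) = fun p => (g (σ' p), h (τ' p))) :
    S.image (fun p => h (τ p)) = S.image fun p => g (σ p) := by
  have h1 : ∀ p ∈ S, h (τ p) = g (σ' p) := by
    intro p hp
    have := congrFun H p
    simp only [swapOn, hp, if_true, Prod.swap_prod_mk, Prod.mk.injEq] at this
    exact this.1
  have h2 : ∀ p ∉ S, σ p = σ' p := by
    intro p hp
    have := congrFun H p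
    simp only [swapOn, hp, if_false, Prod.mk.injEq] at this
    exact hg this.1
  have h3 : S.image σ' = S.image σ := by
    have : Sᶜ.image σ = Sᶜ.image σ' := Finset.image_congr fun p hp => h2 p (by simpa using hp)
    have e : ∀ ρ : Equiv.Perm (Fin n), S.image ρ = (Sᶜ.image ρ)ᶜ := by
      intro ρ
      ext a
      obtain ⟨p, rfl⟩ := ρ.surjective a
      simp
    rw [e, e, this]
  calc S.image (fun p => h (τ p)) = S.image fun p => g (σ' p) := Finset.image_congr h1
    _ = (S.image σ').image g := by rw [Finset.image_image]; rfl
    _ = (S.image σ).image g := by rw [h3]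
    _ = _ := by rw [Finset.image_image]; rfl

theorem pairTensor_le_one (hg : Function.Injective g) (hh : Function.Injective h)
    (c : Fin n → Fin m × Fin m) : pairTensor g h c ≤ 1 := by
  by_cases H : ∃ σ τ : Equiv.Perm (Fin n), c = fun p => (g (σ p), h (τ p))
  · obtain ⟨σ, τ, rfl⟩ := H
    have : ∀ σ' τ' : Equiv.Perm (Fin n), ((fun p => (g (σ p), h (τ p))) = fun p =>
        (g (σ' p), h (τ' p))) ↔ (σ' = σ ∧ τ' = τ) := by
      intro σ' τ'
      constructor
      · intro e
        have e' := fun p => Prod.mk.inj (congrFun e p)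
        exact ⟨Equiv.ext fun p => (hg (e' p).1).symm, Equiv.ext fun p => (hh (e' p).2).symm⟩
      · rintro ⟨rfl, rfl⟩
        rfl
    simp only [pairTensor, this, ite_and]
    simp
  · push Not at H
    simp [pairTensor, H]

theorem pairTensor_swapOn_le (hg : Function.Injective g) (hh : Function.Injective h)
    (S : Finset (Fin n)) (σ τ : Equiv.Perm (Fin n)) :
    pairTensor g h (swapOn S fun p => (g (σ p), h (τ p)))
      ≤ if S.image (fun p => h (τ p)) = S.image (fun p => g (σ p)) then 1 else 0 := by
  split_ifs with H
  · exact pairTensor_le_one hg hh _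
  · refine le_of_eq (Finset.sum_eq_zero fun σ' _ => Finset.sum_eq_zero fun τ' _ => if_neg ?_)
    exact fun e => H (image_eq_of_swapOn_eq hg e)

/-! ### Counting permutations with a prescribed image of a set. -/

/-- Relative to one such permutation, every other is a permutation of S together with one of its
complement. -/
theorem card_perm_image_eq_le (S T : Finset (Fin n)) :
    (Finset.univ.filter fun τ : Equiv.Perm (Fin n) => S.image τ = T).card
      ≤ S.card.factorial * (n - S.card).factorial := by
  by_cases H : ∃ τ₀ : Equiv.Perm (Fin n), S.image τ₀ = T
  · obtain ⟨τ₀, rfl⟩ := H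
    have hmem : ∀ τ : Equiv.Perm (Fin n), S.image τ = S.image τ₀ →
        ∀ p, p ∈ S ↔ (τ₀⁻¹ * τ) p ∈ S := by
      intro τ hτ p
      have h1 : p ∈ S ↔ τ p ∈ S.image τ := by simp
      have h2 : (τ₀⁻¹ * τ) p ∈ S ↔ τ₀ ((τ₀⁻¹ * τ) p) ∈ S.image τ₀ :=
        (τ₀.injective.mem_finset_image).symm
      rw [h1, h2, hτ]
      simp
    let f : {τ : Equiv.Perm (Fin n) // S.image τ = S.image τ₀} →
        Equiv.Perm {p // p ∈ S} × Equiv.Perm {p // p ∉ S} := fun τ =>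
      ((τ₀⁻¹ * τ.1).subtypePerm (p := fun p => p ∈ S) fun p => (hmem τ.1 τ.2 p).symm,
        (τ₀⁻¹ * τ.1).subtypePerm (p := fun p => p ∉ S) fun p => not_congr (hmem τ.1 τ.2 p).symm)
    have hf : Function.Injective f := by
      rintro ⟨τ, hτ⟩ ⟨τ', hτ'⟩ e
      have e1 := congrArg Prod.fst e
      have e2 := congrArg Prod.snd e
      have : τ₀⁻¹ * τ = τ₀⁻¹ * τ' := by
        ext p : 1
        by_cases hp : p ∈ S
        · simpa [f] using congrArg Subtype.val (Equiv.congr_fun e1 ⟨p, hp⟩)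
        · simpa [f] using congrArg Subtype.val (Equiv.congr_fun e2 ⟨p, hp⟩)
      exact Subtype.ext (mul_left_cancel this)
    have := Fintype.card_le_of_injective f hf
    rw [Fintype.card_subtype, Fintype.card_prod, Fintype.card_perm, Fintype.card_perm] at this
    simpa [Fintype.card_subtype_compl] using this
  · push Not at H
    simp [H]

theorem sum_choose_mul_factorial_le (n : ℕ) {l : ℕ} (hl : l ≤ n) :
    (∑ j ∈ Finset.range (l + 1), l.choose j * (j.factorial * (n - j).factorial) : ℕ)
      ≤ (n + 1) * n.factorial := by
  calc _ ≤ ∑ j ∈ Finset.range (l + 1), n.factorial := by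
        refine Finset.sum_le_sum fun j hj => ?_
        have hj' : j ≤ n := (Nat.lt_succ_iff.1 (Finset.mem_range.1 hj)).trans hl
        rw [← Nat.choose_mul_factorial_mul_factorial hj', mul_assoc]
        exact Nat.mul_le_mul_right _ (Nat.choose_le_choose j hl)
    _ ≤ _ := by
        rw [Finset.sum_const, Finset.card_range, smul_eq_mul]
        exact Nat.mul_le_mul_right _ (by omega)

/-- The extreme case is l = n - 1, where the j-th term is (n - j)(n - 1)! and the sum is arithmetic.
The factor 2 is the gain for distinct output strings. -/
theorem two_mul_sum_choose_mul_factorial_le (n : ℕ) {l : ℕ} (hl : l < n) :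
    2 * (∑ j ∈ Finset.range (l + 1), l.choose j * (j.factorial * (n - j).factorial) : ℕ)
      ≤ (n + 1) * n.factorial := by
  obtain ⟨k, rfl⟩ : ∃ k, n = k + 1 := ⟨n - 1, by omega⟩
  have h1 : ∑ j ∈ Finset.range (k + 1), (k + 1 - j) * 2 = (k + 1) * (k + 2) := by
    rw [← Finset.sum_mul, ← Finset.sum_range_reflect]
    have : ∀ j ∈ Finset.range (k + 1), k + 1 - (k + 1 - 1 - j) = j + 1 := by
      intro j hj
      have := Finset.mem_range.1 hj
      omega
    rw [Finset.sum_congr rfl this, Finset.sum_add_distrib, add_mul, Finset.sum_range_id_mul_two]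
    simp
    ring
  calc 2 * (∑ j ∈ Finset.range (l + 1), l.choose j * (j.factorial * (k + 1 - j).factorial) : ℕ)
      ≤ 2 * ∑ j ∈ Finset.range (l + 1), (k + 1 - j) * k.factorial := by
        refine Nat.mul_le_mul_left _ (Finset.sum_le_sum fun j hj => ?_)
        have hj' : j ≤ k := by have := Finset.mem_range.1 hj; omega
        have e : k + 1 - j = (k - j) + 1 := by omega
        rw [e, Nat.factorial_succ, ← Nat.choose_mul_factorial_mul_factorial hj']
        calc l.choose j * (j.factorial * ((k - j + 1) * (k - j).factorial))
            = (k - j + 1) * (l.choose j * j.factorial * (k - j).factorial) := by ring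
          _ ≤ (k - j + 1) * (k.choose j * j.factorial * (k - j).factorial) := by
            have : l ≤ k := by omega
            gcongr
    _ ≤ 2 * ∑ j ∈ Finset.range (k + 1), (k + 1 - j) * k.factorial := by
        refine Nat.mul_le_mul_left _ (Finset.sum_le_sum_of_subset ?_)
        exact Finset.range_subset_range.2 (by omega)
    _ = (k + 1 + 1) * (k + 1).factorial := by
        rw [← Finset.sum_mul, Nat.factorial_succ]
        rw [← Finset.sum_mul] at h1
        linear_combination k.factorial * h1

/-- For fixed σ a swap set S contributes only if τ carries it so that h(τ(S)) = g(σ(S)). This forces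
S into the set `L` of positions whose row under g ∘ σ is also a row of h, and then leaves at most
|S|!(n - |S|)! choices of τ. Since g and h have equally many rows, `L` is everything only when their
images agree. -/
theorem sum_pairTensor_swapOn_le (hg : Function.Injective g) (hh : Function.Injective h)
    (σ : Equiv.Perm (Fin n)) :
    ∑ τ : Equiv.Perm (Fin n), ∑ S : Finset (Fin n),
      pairTensor g h (swapOn S fun p => (g (σ p), h (τ p)))
      ≤ (((if Finset.univ.image g = Finset.univ.image h then (n + 1 : ℝ) else (n + 1) / 2))
        * n.factorial : ℝ) := by
  classical
  set L : Finset (Fin n) := Finset.univ.filter fun p => g (σ p) ∈ Finset.univ.image h with hL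
  have hLn : L.card ≤ n := by simpa using Finset.card_le_univ L
  have hcount : ∀ S : Finset (Fin n), (Finset.univ.filter fun τ : Equiv.Perm (Fin n) =>
      S.image (fun p => h (τ p)) = S.image fun p => g (σ p)).card
      ≤ if S ⊆ L then S.card.factorial * (n - S.card).factorial else 0 := by
    intro S
    split_ifs with hS
    · have key : ∃ T : Finset (Fin n), T.image h = S.image fun p => g (σ p) := by
        refine Finset.subset_univ_image_iff.1 ?_
        intro a ha
        obtain ⟨p, hp, rfl⟩ := Finset.mem_image.1 ha
        exact (Finset.mem_filter.1 (hS hp)).2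
      obtain ⟨T, hT⟩ := key
      refine le_trans (Finset.card_le_card ?_) (card_perm_image_eq_le S T)
      intro τ hτ
      simp only [Finset.mem_filter, Finset.mem_univ, true_and] at hτ ⊢
      apply Finset.image_injective hh
      rw [hT, ← hτ, Finset.image_image]
      rfl
    · rw [Nat.le_zero, Finset.card_eq_zero, Finset.filter_eq_empty_iff]
      intro τ _ e
      refine hS fun p hp => Finset.mem_filter.2 ⟨Finset.mem_univ _, ?_⟩
      have : g (σ p) ∈ S.image fun p => h (τ p) := by
        rw [e]
        exact Finset.mem_image_of_mem _ hp
      obtain ⟨q, _, hq⟩ := Finset.mem_image.1 this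
      rw [← hq]
      exact Finset.mem_image_of_mem _ (Finset.mem_univ _)
  have hnat : ∑ τ : Equiv.Perm (Fin n), ∑ S : Finset (Fin n),
      pairTensor g h (swapOn S fun p => (g (σ p), h (τ p)))
      ≤ ((∑ j ∈ Finset.range (L.card + 1),
          L.card.choose j * (j.factorial * (n - j).factorial) : ℕ) : ℝ) := by
    rw [Finset.sum_comm]
    calc _ ≤ ∑ S : Finset (Fin n), ∑ τ : Equiv.Perm (Fin n),
          if S.image (fun p => h (τ p)) = S.image (fun p => g (σ p)) then (1 : ℝ) else 0 :=
          Finset.sum_le_sum fun S _ => Finset.sum_le_sum fun τ _ =>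
            pairTensor_swapOn_le hg hh S σ τ
      _ = ((∑ S : Finset (Fin n), (Finset.univ.filter fun τ : Equiv.Perm (Fin n) =>
            S.image (fun p => h (τ p)) = S.image fun p => g (σ p)).card : ℕ) : ℝ) := by
          push_cast
          simp only [Finset.sum_boole]
      _ ≤ _ := by
          rw [Nat.cast_le]
          refine (Finset.sum_le_sum fun S _ => hcount S).trans (le_of_eq ?_)
          rw [← Finset.sum_filter]
          have : (Finset.univ.filter fun S => S ⊆ L) = L.powerset := by
            ext S
            simp
          rw [this, Finset.sum_powerset_apply_card fun j => j.factorial * (n - j).factorial]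
          simp only [smul_eq_mul]
  refine hnat.trans ?_
  split_ifs with H
  · exact_mod_cast sum_choose_mul_factorial_le n hLn
  · have hlt : L.card < n := by
      refine lt_of_le_of_ne hLn fun hcard => H ?_
      have hLu : L = Finset.univ := (Finset.card_eq_iff_eq_univ L).1 (by simpa using hcard)
      refine Finset.eq_of_subset_of_card_le ?_ ?_
      · intro a ha
        obtain ⟨p, _, rfl⟩ := Finset.mem_image.1 ha
        have : σ.symm p ∈ L := by rw [hLu]; exact Finset.mem_univ _
        simpa [hL] using this
      · rw [Finset.card_image_of_injective _ hg, Finset.card_image_of_injective _ hh]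
    have h2 := two_mul_sum_choose_mul_factorial_le n hlt
    have h3 : (2 : ℝ) * ((∑ j ∈ Finset.range (L.card + 1),
          L.card.choose j * (j.factorial * (n - j).factorial) : ℕ) : ℝ)
        ≤ (n + 1) * n.factorial := by exact_mod_cast h2
    linarith

theorem sum_symTensor_sq_le (hg : Function.Injective g) (hh : Function.Injective h) :
    ∑ c, symTensor g h c ^ 2
      ≤ (1 / 2 ^ n) * ((if Finset.univ.image g = Finset.univ.image h then (n + 1 : ℝ)
          else (n + 1) / 2) * (n.factorial : ℝ) ^ 2) := by
  rw [sum_symTensor_sq]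
  gcongr
  refine (Finset.sum_le_sum fun σ _ => sum_pairTensor_swapOn_le hg hh σ).trans (le_of_eq ?_)
  rw [Finset.sum_const, Finset.card_univ, Fintype.card_perm, Fintype.card_fin, nsmul_eq_mul]
  ring

end

/-! ### Moments of the ideal probabilities -/

@[fun_prop]
theorem continuous_idealProb {m n : ℕ} (t s : BitString m n) :
    Continuous fun U => idealProb U t s := by
  simp only [idealProb, Matrix.permanent, scatteringMatrix, Matrix.submatrix_apply]
  fun_prop

theorem idealProb_nonneg {m n : ℕ} (U : Matrix.unitaryGroup (Fin m) ℂ) (t s : BitString m n) :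
    0 ≤ idealProb U t s :=
  sq_nonneg _

theorem idealProb_mul_eq {m n : ℕ} (U : Matrix.unitaryGroup (Fin m) ℂ) (t s s' : BitString m n) :
    idealProb U t s * idealProb U t s'
      = ‖∑ c, (symTensor (s.1.orderEmbOfFin s.2) (s'.1.orderEmbOfFin s'.2) c : ℂ)
          * ∏ p, colPair U (t.1.orderEmbOfFin t.2 p) (c p)‖ ^ 2 := by
  have := sum_symTensor_mul (s.1.orderEmbOfFin s.2) (s'.1.orderEmbOfFin s'.2) (R := ℂ)
    (fun c => ∏ p, colPair U (t.1.orderEmbOfFin t.2 p) (c p)) (by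
      intro S c
      refine Finset.prod_congr rfl fun p _ => ?_
      by_cases hp : p ∈ S <;> simp [swapOn, hp, colPair, mul_comm])
  simp only [Complex.coe_algebraMap] at this
  rw [this, idealProb, idealProb, ← mul_pow, ← norm_mul, Matrix.permanent, Matrix.permanent,
    Finset.sum_mul_sum]
  simp only [colPair, Finset.prod_mul_distrib, scatteringMatrix, Matrix.submatrix_apply]

theorem image_orderEmbOfFin {m n : ℕ} (s : BitString m n) :
    Finset.univ.image (s.1.orderEmbOfFin s.2) = s.1 := by
  simp

theorem prod_mul_integral_idealProb_mul_le {m n : ℕ} (t s s' : BitString m n) :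
    (∏ p : Fin n, ((m : ℝ) - (p : ℕ)) * (m - (p : ℕ) + 1) / 2)
        * ∫ U, idealProb U t s * idealProb U t s' ∂haarUnitary m
      ≤ (1 / 2 ^ n) * ((if s = s' then (n + 1 : ℝ) else (n + 1) / 2) * (n.factorial : ℝ) ^ 2) := by
  have h1 := prod_mul_integral_contraction_le n (α := Unit) (t.1.orderEmbOfFin t.2)
    (t.1.orderEmbOfFin t.2).injective
    (fun _ c => (symTensor (s.1.orderEmbOfFin s.2) (s'.1.orderEmbOfFin s'.2) c : ℂ)) (by
      intro _ c c' h
      have : c' = swapOn (Finset.univ.filter fun p => c' p ≠ c p) c := by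
        funext p
        by_cases hp : c' p = c p
        · simp [swapOn, hp]
        · simpa [swapOn, hp] using (h p).resolve_left hp
      rw [this, symTensor_swapOn])
  have h2 := sum_symTensor_sq_le (s.1.orderEmbOfFin s.2).injective
    (s'.1.orderEmbOfFin s'.2).injective
  simp only [image_orderEmbOfFin, ← Subtype.ext_iff] at h2
  simp only [idealProb_mul_eq]
  refine le_trans ?_ h2
  simpa using h1

theorem prod_symSq {m n : ℕ} (hnm : n ≤ m) :
    (∏ p : Fin n, ((m : ℝ) - (p : ℕ)) * (m - (p : ℕ) + 1) / 2) * (m - n + 1)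
      = (1 / 2 ^ n) * ((m.choose n : ℝ) * n.factorial) ^ 2 * (m + 1) := by
  rw [Finset.prod_div_distrib, Finset.prod_mul_distrib, Finset.prod_const, Finset.card_univ,
    Fintype.card_fin, Fin.prod_univ_eq_prod_range (fun p => (m : ℝ) - (p : ℕ)),
    Fin.prod_univ_eq_prod_range (fun p => (m : ℝ) - (p : ℕ) + 1)]
  have h1 : ∏ p ∈ Finset.range n, ((m : ℝ) - (p : ℕ)) = (m.choose n : ℝ) * n.factorial := by
    rw [← Nat.cast_mul, mul_comm, ← Nat.descFactorial_eq_factorial_mul_choose,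
      Nat.descFactorial_eq_prod_range, Nat.cast_prod]
    refine Finset.prod_congr rfl fun p hp => ?_
    rw [Nat.cast_sub ((Finset.mem_range.1 hp).le.trans hnm)]
  -- Both sides are the product of m + 1, m, …, m - n + 1, split off at opposite ends.
  have h2 : (∏ p ∈ Finset.range n, ((m : ℝ) - (p : ℕ) + 1)) * (m - n + 1)
      = (∏ p ∈ Finset.range n, ((m : ℝ) - (p : ℕ))) * (m + 1) := by
    have e := Finset.prod_range_succ (fun p : ℕ => (m : ℝ) - p + 1) n
    have e' := Finset.prod_range_succ' (fun p : ℕ => (m : ℝ) - p + 1) n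
    rw [← e, e']
    congr 1
    · refine Finset.prod_congr rfl fun p _ => ?_
      push_cast
      ring
    · simp
  rw [div_mul_eq_mul_div, mul_assoc, h2, h1]
  ring

theorem integral_idealProb_mul_le {m n : ℕ} (hnm : n ≤ m) (t s s' : BitString m n) :
    ∫ U, idealProb U t s * idealProb U t s' ∂haarUnitary m
      ≤ pUnif m n ^ 2 * ((m - n + 1) / (m + 1)) * ((n + 1) / 2) * (1 + if s = s' then 1 else 0) := by
  have h := prod_mul_integral_idealProb_mul_le t s s'
  have hp := prod_symSq hnm
  set E := ∫ U, idealProb U t s * idealProb U t s' ∂haarUnitary m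
  set Q := ∏ p : Fin n, ((m : ℝ) - (p : ℕ)) * (m - (p : ℕ) + 1) / 2
  have hc : (0 : ℝ) < m.choose n := by exact_mod_cast Nat.choose_pos hnm
  have hf : (0 : ℝ) < n.factorial := by exact_mod_cast n.factorial_pos
  have hd : (0 : ℝ) < m - n + 1 := by
    have : (n : ℝ) ≤ m := by exact_mod_cast hnm
    linarith
  have h1 := mul_le_mul_of_nonneg_right h hd.le
  have h2 : Q * E * (m - n + 1) = ((1 / 2 ^ n) * (n.factorial : ℝ) ^ 2)
      * ((m.choose n : ℝ) ^ 2 * (m + 1) * E) := by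
    linear_combination E * hp
  have h3 : (if s = s' then (n + 1 : ℝ) else (n + 1) / 2)
      = (n + 1) / 2 * (1 + if s = s' then 1 else 0) := by
    split_ifs <;> ring
  rw [h2, h3] at h1
  have h4 : (m.choose n : ℝ) ^ 2 * (m + 1) * E
      ≤ (n + 1) / 2 * (1 + if s = s' then 1 else 0) * (m - n + 1) := by
    refine le_of_mul_le_mul_left (h1.trans (le_of_eq ?_))
      (by positivity : (0 : ℝ) < (1 / 2 ^ n) * (n.factorial : ℝ) ^ 2)
    ring
  have h5 : pUnif m n ^ 2 * ((m - n + 1) / (m + 1)) * ((n + 1) / 2) * (1 + if s = s' then 1 else 0)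
      = (n + 1) / 2 * (1 + if s = s' then 1 else 0) * (m - n + 1)
        / ((m.choose n : ℝ) ^ 2 * (m + 1)) := by
    unfold pUnif
    field_simp
  rw [h5, le_div_iff₀ (by positivity)]
  linarith

/-- Right invariance makes all entries of a row equidistributed, and a row has norm one. -/
theorem integral_norm_sq_apply {m : ℕ} (i j : Fin m) :
    ∫ U : Matrix.unitaryGroup (Fin m) ℂ, ‖U.1 i j‖ ^ 2 ∂haarUnitary m = 1 / m := by
  have hcol : ∀ k, ∫ U : Matrix.unitaryGroup (Fin m) ℂ, ‖U.1 i k‖ ^ 2 ∂haarUnitary m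
      = ∫ U : Matrix.unitaryGroup (Fin m) ℂ, ‖U.1 i j‖ ^ 2 ∂haarUnitary m := by
    intro k
    obtain ⟨D, -, hD⟩ := exists_unitary_column ∅ (Finset.notMem_empty j) (Pi.single k 1) (by simp)
      (by rw [Finset.sum_eq_single k] <;> simp +contextual)
    rw [← integral_mul_right_eq_self (μ := haarUnitary m)
      (fun U : Matrix.unitaryGroup (Fin m) ℂ => ‖U.1 i j‖ ^ 2) D]
    refine integral_congr_ae (Filter.Eventually.of_forall fun U => ?_)
    simp [Matrix.mul_apply, hD, Pi.single_apply]
  have hsum : ∑ k, ∫ U : Matrix.unitaryGroup (Fin m) ℂ, ‖U.1 i k‖ ^ 2 ∂haarUnitary m = 1 := by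
    rw [← integral_finsetSum _ fun k _ => integrable_haarUnitary (by fun_prop)]
    have : ∀ U : Matrix.unitaryGroup (Fin m) ℂ, ∑ k, ‖U.1 i k‖ ^ 2 = 1 := by
      intro U
      have h := congrFun (congrFun (Matrix.mem_unitaryGroup_iff.1 U.2) i) i
      rw [Matrix.mul_apply, Matrix.one_apply_eq] at h
      apply Complex.ofReal_injective
      simpa [Matrix.star_apply, Complex.mul_conj'] using h
    simp [this]
  have hm : (m : ℝ) ≠ 0 := by
    have : 0 < m := i.pos
    positivity
  rw [Finset.sum_congr rfl fun k _ => hcol k, Finset.sum_const, Finset.card_univ,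
    Fintype.card_fin, nsmul_eq_mul] at hsum
  field_simp
  linarith

/-- The 2 × 2 permanent is an off-diagonal entry of U^T q U with q = E_ab + E_ba. Nothing is frozen
here, so the symmetric-square bound becomes an equality: m(m+1)/2 · M = ‖q‖² = 2, and the
off-diagonal mean is M/2. -/
theorem integral_norm_sq_permanent_two {m : ℕ} {a b i j : Fin m} (hab : a ≠ b) (hij : i ≠ j) :
    ∫ U : Matrix.unitaryGroup (Fin m) ℂ, ‖U.1 a i * U.1 b j + U.1 b i * U.1 a j‖ ^ 2 ∂haarUnitary m
      = 2 / (m * (m + 1)) := by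
  classical
  set q : Matrix (Fin m) (Fin m) ℂ := Matrix.single a b 1 + Matrix.single b a 1 with hq
  set K : Unit → Matrix.unitaryGroup (Fin m) ℂ → Matrix (Fin m) (Fin m) ℂ :=
    fun _ U => U.1.transpose * q * U.1 with hK
  set M := ∫ U : Matrix.unitaryGroup (Fin m) ℂ, ‖2 * (U.1 a i * U.1 b i)‖ ^ 2 ∂haarUnitary m
    with hMdef
  have hform : ∀ v : Fin m → ℂ, v ⬝ᵥ q.mulVec v = 2 * (v a * v b) := by
    intro v
    simp only [hq, Matrix.add_mulVec, dotProduct_add, Matrix.single_mulVec]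
    simp [dotProduct, Function.update_apply]
    ring
  have hentry : ∀ U k l, K () U k l = U.1 a k * U.1 b l + U.1 b k * U.1 a l := by
    intro U k l
    simp only [hK, hq, Matrix.mul_add, Matrix.add_mul, Matrix.add_apply, Matrix.mul_apply,
      Matrix.transpose_apply, Matrix.single_apply]
    simp [ite_and]
  have hc : ∀ x k l, Continuous fun U => K x U k l := by
    intro x k l
    simp only [hentry]
    fun_prop
  have hs : ∀ x U k l, K x U k l = K x U l k := by
    intro x U k l
    simp only [hentry]
    ring
  have hM : ∀ w : Fin m → ℂ, (∀ i ∉ (Finset.univ : Finset (Fin m)), w i = 0) →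
      ∑ i, ‖w i‖ ^ 2 = 1 → ∫ U, ∑ x, ‖w ⬝ᵥ (K x U).mulVec w‖ ^ 2 ∂haarUnitary m = M := by
    intro w _ hn
    obtain ⟨D, -, hD⟩ := exists_unitary_column ∅ (Finset.notMem_empty i) w (by simp) hn
    rw [hMdef, ← integral_mul_right_eq_self (μ := haarUnitary m)
      (fun U : Matrix.unitaryGroup (Fin m) ℂ => ‖2 * (U.1 a i * U.1 b i)‖ ^ 2) D]
    refine integral_congr_ae (Filter.Eventually.of_forall fun U => ?_)
    have hcol : ∀ k, (U * D).1 k i = U.1.mulVec w k := by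
      intro k
      rw [Submonoid.coe_mul, Matrix.mul_apply]
      simp [hD, Matrix.mulVec, dotProduct]
    simp only [hcol, hK, Finset.univ_unique, Finset.sum_singleton]
    rw [Matrix.mul_assoc, ← Matrix.mulVec_mulVec, Matrix.dotProduct_mulVec,
      Matrix.vecMul_transpose, ← Matrix.mulVec_mulVec, hform]
  have hoff : ∀ k l, k ≠ l → ∫ U, ‖K () U k l‖ ^ 2 ∂haarUnitary m = M / 2 := by
    intro k l hkl
    simpa using integral_offDiag_of_invariant hc hs hM (Finset.mem_univ k) (Finset.mem_univ l) hkl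
  have hdiag : ∀ k, ∫ U, ‖K () U k k‖ ^ 2 ∂haarUnitary m = M := by
    intro k
    simpa using integral_diag_of_invariant hM (Finset.mem_univ k)
  have htot : ∑ k, ∑ l, ∫ U, ‖K () U k l‖ ^ 2 ∂haarUnitary m = 2 := by
    have hpt : ∀ U, ∑ k, ∑ l, ‖K () U k l‖ ^ 2 = 2 := by
      intro U
      simp only [hK]
      rw [sum_norm_sq_unitary_conj]
      have : ∀ k l, ‖q k l‖ ^ 2
          = (if k = a then if l = b then 1 else 0 else 0)
            + (if k = b then if l = a then (1 : ℝ) else 0 else 0) := by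
        intro k l
        simp only [hq, Matrix.add_apply, Matrix.single_apply]
        by_cases h1 : k = a
        · subst h1
          rcases eq_or_ne l b with rfl | h2 <;> simp [*, hab.symm, Ne.symm]
        · by_cases h2 : k = b
          · subst h2
            rcases eq_or_ne l a with rfl | h3 <;> simp [*, Ne.symm]
          · simp [h1, h2, Ne.symm h1, Ne.symm h2]
      simp only [this, Finset.sum_add_distrib]
      simp
      norm_num
    have hrow : ∀ k, ∑ l, ∫ U, ‖K () U k l‖ ^ 2 ∂haarUnitary m
        = ∫ U, ∑ l, ‖K () U k l‖ ^ 2 ∂haarUnitary m := fun k =>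
      (integral_finsetSum _ fun l _ => integrable_haarUnitary ((hc () k l).norm.pow 2)).symm
    have hrows : ∑ k, ∫ U, ∑ l, ‖K () U k l‖ ^ 2 ∂haarUnitary m
        = ∫ U, ∑ k, ∑ l, ‖K () U k l‖ ^ 2 ∂haarUnitary m :=
      (integral_finsetSum _ fun k _ => integrable_haarUnitary
        (continuous_finsetSum _ fun l _ => (hc () k l).norm.pow 2)).symm
    rw [Finset.sum_congr rfl fun k _ => hrow k, hrows]
    simp [hpt]
  have hval : ∀ k l, ∫ U, ‖K () U k l‖ ^ 2 ∂haarUnitary m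
      = (if k = l then M / 2 else 0) + M / 2 := by
    intro k l
    split_ifs with h
    · subst h
      rw [hdiag]
      ring
    · rw [hoff k l h, zero_add]
  have h := hoff i j hij
  simp only [hentry] at h
  rw [h]
  simp only [hval, Finset.sum_add_distrib, Finset.sum_ite_eq, Finset.mem_univ, if_true,
    Finset.sum_const, Finset.card_univ, Fintype.card_fin, nsmul_eq_mul] at htot
  have hm : (0 : ℝ) < m := by exact_mod_cast i.pos
  rw [eq_div_iff (by positivity)]
  linarith


/-! ### Counting the summands of the interference term -/

section

variable {m n k : ℕ}

theorem card_lossyStrings (hkn : k ≤ n) (s : BitString m n) :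
    (lossyStrings k s).card = n.choose k := by
  have : (lossyStrings k s).card = (s.1.powersetCard (n - k)).card := by
    refine Finset.card_bij (fun r _ => r.1) ?_ (fun _ _ _ _ h => Subtype.ext h) ?_
    · intro r hr
      exact Finset.mem_powersetCard.2 ⟨(Finset.mem_filter.1 hr).2, r.2⟩
    · intro r hr
      obtain ⟨h1, h2⟩ := Finset.mem_powersetCard.1 hr
      exact ⟨⟨r, h2⟩, Finset.mem_filter.2 ⟨Finset.mem_univ _, h1⟩, rfl⟩
  rw [this, Finset.card_powersetCard, s.2, Nat.choose_symm hkn]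

theorem card_parentStrings (hkn : k ≤ n) (hnm : n ≤ m) (r : BitString m (n - k)) :
    (parentStrings n r).card = (m - n + k).choose k := by
  have : (parentStrings n r).card = (r.1ᶜ.powersetCard (m - n)).card := by
    refine Finset.card_bij (fun s _ => s.1ᶜ) ?_
      (fun _ _ _ _ h => Subtype.ext (compl_injective h)) ?_
    · intro s hs
      refine Finset.mem_powersetCard.2
        ⟨Finset.compl_subset_compl.2 (Finset.mem_filter.1 hs).2, ?_⟩
      rw [Finset.card_compl, s.2, Fintype.card_fin]
    · intro s hs
      obtain ⟨h1, h2⟩ := Finset.mem_powersetCard.1 hs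
      refine ⟨⟨sᶜ, ?_⟩, Finset.mem_filter.2 ⟨Finset.mem_univ _, ?_⟩, compl_compl s⟩
      · rw [Finset.card_compl, h2, Fintype.card_fin]
        omega
      · exact Finset.subset_compl_comm.1 h1
  rw [this, Finset.card_powersetCard, Finset.card_compl, r.2, Fintype.card_fin]
  have e : m - (n - k) = m - n + k := by omega
  rw [e, Nat.choose_symm_add]

/-- The pairs of a lossy string `r` of `s` and a parent of `r` other than `s`. -/
def interferencePairs (k : ℕ) (s : BitString m n) :
    Finset ((_ : BitString m (n - k)) × BitString m n) :=
  (lossyStrings k s).sigma fun r => (parentStrings n r).erase s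

theorem card_interferencePairs (hkn : k ≤ n) (hnm : n ≤ m) (s : BitString m n) :
    ((interferencePairs k s).card : ℝ) = interferenceCount m n k := by
  have h : ∀ r ∈ lossyStrings k s, ((parentStrings n r).erase s).card
      = (m - n + k).choose k - 1 := by
    intro r hr
    rw [Finset.card_erase_of_mem, card_parentStrings hkn hnm]
    exact Finset.mem_filter.2 ⟨Finset.mem_univ _, (Finset.mem_filter.1 hr).2⟩
  rw [interferencePairs, Finset.card_sigma, Finset.sum_congr rfl h, Finset.sum_const,
    card_lossyStrings hkn, smul_eq_mul, interferenceCount, Nat.cast_mul, Nat.cast_sub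
    (Nat.choose_pos (Nat.le_add_left k _)), Nat.cast_one, mul_comm]

theorem interference_eq_sum (U : Matrix.unitaryGroup (Fin m) ℂ) (t s : BitString m n) :
    interference U t k s
      = (1 / interferenceCount m n k) * ∑ x ∈ interferencePairs k s, idealProb U t x.2 := by
  rw [interference, interferencePairs, Finset.sum_sigma, Finset.mul_sum]
  refine Finset.sum_congr rfl fun r _ => ?_
  rw [← Finset.sum_mul, mul_comm]

/-- The lossy string must lie in s ∩ s', which has at most n - 1 elements. -/
theorem card_filter_interferencePairs_le (hk : 1 ≤ k) (hkn : k ≤ n) {s s' : BitString m n}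
    (hs : s' ≠ s) :
    ((interferencePairs k s).filter fun x => s' = x.2).card ≤ (n - 1).choose (k - 1) := by
  have hlt : (s.1 ∩ s'.1).card ≤ n - 1 := by
    have hne : s.1 ∩ s'.1 ≠ s.1 := by
      intro h
      refine hs (Subtype.ext (Finset.eq_of_subset_of_card_le (Finset.inter_eq_left.1 h) ?_).symm)
      rw [s.2, s'.2]
    have := Finset.card_lt_card (Finset.inter_subset_left.ssubset_of_ne hne)
    rw [s.2] at this
    omega
  calc _ ≤ ((s.1 ∩ s'.1).powersetCard (n - k)).card := by
        refine Finset.card_le_card_of_injOn (fun x => x.1.1) ?_ ?_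
        · rintro ⟨r, s₁⟩ hx
          obtain ⟨hx, rfl⟩ := Finset.mem_filter.1 hx
          obtain ⟨h1, h2⟩ := Finset.mem_sigma.1 hx
          exact Finset.mem_powersetCard.2 ⟨Finset.subset_inter (Finset.mem_filter.1 h1).2
            (Finset.mem_filter.1 (Finset.mem_of_mem_erase h2)).2, r.2⟩
        · rintro ⟨r, s₁⟩ hx ⟨r', s₂⟩ hy h
          obtain ⟨-, rfl⟩ := Finset.mem_filter.1 hx
          obtain ⟨-, rfl⟩ := Finset.mem_filter.1 hy
          obtain rfl : r = r' := Subtype.ext h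
          rfl
    _ = (s.1 ∩ s'.1).card.choose (n - k) := Finset.card_powersetCard _ _
    _ ≤ (n - 1).choose (n - k) := Nat.choose_le_choose _ hlt
    _ = (n - 1).choose (k - 1) := by
        rw [← Nat.choose_symm (by omega : k - 1 ≤ n - 1)]
        congr 1
        omega

theorem one_add_mul_le_choose (d k : ℕ) : 1 + d * k ≤ (d + k).choose k := by
  induction d generalizing k with
  | zero => simp
  | succ d ihd =>
    induction k with
    | zero => simp
    | succ k ihk =>
      have h1 := ihd (k + 1)
      have e : (d + 1 + (k + 1)).choose (k + 1)
          = (d + 1 + k).choose k + (d + (k + 1)).choose (k + 1) := by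
        rw [show d + 1 + (k + 1) = (d + 1 + k) + 1 by ring, Nat.choose_succ_succ',
          show d + 1 + k = d + (k + 1) by ring]
      rw [e]
      nlinarith

/-- From n C(n-1, k-1) = k C(n, k) and C(m-n+k, k) - 1 ≥ k(m-n). It bounds the fraction of pairs
sharing a given output string by 1/(n(m-n)). -/
theorem mul_choose_le_interferenceCount (hk : 1 ≤ k) (hkn : k ≤ n) (hnm : n < m) :
    ((n : ℝ) * (m - n)) * ((n - 1).choose (k - 1) : ℝ) ≤ interferenceCount m n k := by
  obtain ⟨k, rfl⟩ : ∃ j, k = j + 1 := ⟨k - 1, by omega⟩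
  obtain ⟨n, rfl⟩ : ∃ j, n = j + 1 := ⟨n - 1, by omega⟩
  have h1 : ((n + 1 : ℕ) : ℝ) * (n.choose k : ℝ)
      = ((n + 1).choose (k + 1) : ℝ) * ((k + 1 : ℕ) : ℝ) := by
    exact_mod_cast Nat.add_one_mul_choose_eq n k
  have h2 : (1 : ℝ) + (m - (n + 1 : ℕ)) * (k + 1 : ℕ)
      ≤ ((m - (n + 1) + (k + 1)).choose (k + 1) : ℝ) := by
    rw [← Nat.cast_sub hnm.le]
    exact_mod_cast one_add_mul_le_choose (m - (n + 1)) (k + 1)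
  have hd : (0 : ℝ) ≤ (m - (n + 1 : ℕ)) := by
    rw [← Nat.cast_sub hnm.le]
    positivity
  unfold interferenceCount
  simp only [Nat.add_sub_cancel]
  calc (((n + 1 : ℕ) : ℝ) * (m - (n + 1 : ℕ))) * (n.choose k : ℝ)
      = (m - (n + 1 : ℕ)) * (k + 1 : ℕ) * ((n + 1).choose (k + 1) : ℝ) := by
        linear_combination ((m : ℝ) - (n + 1 : ℕ)) * h1
    _ ≤ _ := by
        gcongr
        linarith

theorem interferenceCount_pos (hk : 1 ≤ k) (hkn : k ≤ n) (hnm : n < m) :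
    0 < interferenceCount m n k := by
  refine lt_of_lt_of_le ?_ (mul_choose_le_interferenceCount hk hkn hnm)
  have h1 : (0 : ℝ) < (n - 1).choose (k - 1) := by
    exact_mod_cast Nat.choose_pos (by omega)
  have h2 : (0 : ℝ) < n := by exact_mod_cast (by omega : 0 < n)
  have h3 : (0 : ℝ) < m - n := by
    rw [sub_pos]
    exact_mod_cast hnm
  positivity

/-! ### Moments of the interference term -/

@[fun_prop]
theorem continuous_interference (t s : BitString m n) :
    Continuous fun U => interference U t k s := by
  unfold interference
  fun_prop

theorem integral_interference_of_const (hk : 1 ≤ k) (hkn : k ≤ n) (hnm : n < m)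
    (t s : BitString m n) {a : ℝ} (ha : ∀ s', ∫ U, idealProb U t s' ∂haarUnitary m = a) :
    ∫ U, interference U t k s ∂haarUnitary m = a := by
  simp only [interference_eq_sum]
  rw [integral_const_mul, integral_finsetSum _ fun x _ => integrable_haarUnitary (by fun_prop)]
  simp only [ha, Finset.sum_const, nsmul_eq_mul, card_interferencePairs hkn hnm.le]
  have := (interferenceCount_pos hk hkn hnm).ne'
  field_simp

theorem integral_interference_sq_le (hk : 1 ≤ k) (hkn : k ≤ n) (hnm : n < m)
    (t s : BitString m n) :
    ∫ U, interference U t k s ^ 2 ∂haarUnitary m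
      ≤ pUnif m n ^ 2 * ((m - n + 1) / (m + 1)) * ((n + 1) / 2) * (1 + 1 / (n * (m - n))) := by
  classical
  set C : ℝ := pUnif m n ^ 2 * ((m - n + 1) / (m + 1)) * ((n + 1) / 2) with hC
  set N := interferenceCount m n k with hN
  have hd : (0 : ℝ) < m - n := by
    rw [sub_pos]
    exact_mod_cast hnm
  have hn0 : (0 : ℝ) < n := by exact_mod_cast (by omega : 0 < n)
  have hC0 : 0 ≤ C := by positivity
  have hN0 : 0 < N := interferenceCount_pos hk hkn hnm
  have hcard : ((interferencePairs k s).card : ℝ) = N := card_interferencePairs hkn hnm.le s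
  have hsq : ∀ U, interference U t k s ^ 2 = (1 / N) ^ 2 * ∑ x ∈ interferencePairs k s,
      ∑ y ∈ interferencePairs k s, idealProb U t x.2 * idealProb U t y.2 := by
    intro U
    rw [interference_eq_sum, mul_pow, sq (∑ x ∈ _, _), Finset.sum_mul_sum]
  have hinner : ∀ x ∈ interferencePairs k s,
      ∑ y ∈ interferencePairs k s, (1 + if x.2 = y.2 then (1 : ℝ) else 0)
        ≤ N * (1 + 1 / (n * (m - n))) := by
    intro x hx
    have h1 : (((interferencePairs k s).filter fun y => x.2 = y.2).card : ℝ)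
        ≤ ((n - 1).choose (k - 1) : ℝ) := by
      exact_mod_cast card_filter_interferencePairs_le hk hkn
        (Finset.ne_of_mem_erase (Finset.mem_sigma.1 hx).2)
    have h2 := mul_choose_le_interferenceCount hk hkn hnm
    rw [Finset.sum_add_distrib, Finset.sum_const, nsmul_eq_mul, hcard, Finset.sum_boole, mul_add]
    refine add_le_add le_rfl (h1.trans ?_)
    rw [mul_one_div, le_div_iff₀ (by positivity)]
    linarith
  simp only [hsq]
  rw [integral_const_mul, integral_finsetSum _ fun x _ => integrable_haarUnitary (by fun_prop)]
  calc _ ≤ (1 / N) ^ 2 * ∑ x ∈ interferencePairs k s, C * (N * (1 + 1 / (n * (m - n)))) := by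
        gcongr with x hx
        rw [integral_finsetSum _ fun y _ => integrable_haarUnitary (by fun_prop)]
        refine le_trans ?_ (mul_le_mul_of_nonneg_left (hinner x hx) hC0)
        rw [Finset.mul_sum]
        exact Finset.sum_le_sum fun y _ => integral_idealProb_mul_le hnm.le t x.2 y.2
    _ = _ := by
        rw [Finset.sum_const, nsmul_eq_mul, hcard]
        field_simp

theorem integral_idealProb_one (t s : BitString m 1) :
    ∫ U, idealProb U t s ∂haarUnitary m = 1 / m := by
  have : ∀ U, idealProb U t s
      = ‖U.1 (s.1.orderEmbOfFin s.2 0) (t.1.orderEmbOfFin t.2 0)‖ ^ 2 := by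
    intro U
    simp [idealProb, Matrix.permanent, scatteringMatrix]
  simp only [this, integral_norm_sq_apply]

theorem integral_idealProb_two (t s : BitString m 2) :
    ∫ U, idealProb U t s ∂haarUnitary m = 2 / (m * (m + 1)) := by
  have h01 : ∀ s : BitString m 2, s.1.orderEmbOfFin s.2 0 ≠ s.1.orderEmbOfFin s.2 1 := by
    intro s h
    exact absurd ((s.1.orderEmbOfFin s.2).injective h) (by decide)
  rw [← integral_norm_sq_permanent_two (h01 s) (h01 t)]
  refine integral_congr_ae (Filter.Eventually.of_forall fun U => ?_)
  have : (Finset.univ : Finset (Equiv.Perm (Fin 2))) = {1, Equiv.swap 0 1} := by decide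
  simp only [idealProb, Matrix.permanent, this, scatteringMatrix]
  rw [Finset.sum_pair (by decide)]
  simp

/-- The mean square deviation of the interference term from the uniform probability. -/
theorem integral_interference_sub_sq_le (hk : 1 ≤ k) (hkn : k ≤ n) (hnm : n < m)
    (t s : BitString m n) :
    ∫ U, (interference U t k s - pUnif m n) ^ 2 ∂haarUnitary m ≤ n * pUnif m n ^ 2 := by
  have hexp : ∫ U, (interference U t k s - pUnif m n) ^ 2 ∂haarUnitary m
      = ∫ U, interference U t k s ^ 2 ∂haarUnitary m
        - 2 * pUnif m n * ∫ U, interference U t k s ∂haarUnitary m + pUnif m n ^ 2 := by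
    have i1 : Integrable (fun U => interference U t k s ^ 2) (haarUnitary m) :=
      integrable_haarUnitary (by fun_prop)
    have i2 : Integrable (fun U => 2 * pUnif m n * interference U t k s) (haarUnitary m) :=
      integrable_haarUnitary (by fun_prop)
    have i12 : Integrable (fun U => interference U t k s ^ 2
        - 2 * pUnif m n * interference U t k s) (haarUnitary m) := i1.sub i2
    rw [← integral_const_mul, ← integral_sub i1 i2]
    have : pUnif m n ^ 2 = ∫ _ : Matrix.unitaryGroup (Fin m) ℂ, pUnif m n ^ 2 ∂haarUnitary m := by
      simp
    rw [this, ← integral_add i12 (integrable_const _)]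
    refine integral_congr_ae (Filter.Eventually.of_forall fun U => ?_)
    ring
  have hsq := integral_interference_sq_le hk hkn hnm t s
  have hn1 : 1 ≤ n := hk.trans hkn
  have hmn : (n : ℝ) + 1 ≤ m := by exact_mod_cast hnm
  have hn0 : (1 : ℝ) ≤ n := by exact_mod_cast hn1
  have hp2 : 0 ≤ pUnif m n ^ 2 := sq_nonneg _
  -- With d = m - n and denominators cleared this reads d + 1 ≤ n² d, which fails for n = 1.
  have hcoef : 2 ≤ n → ((m : ℝ) - n + 1) / (m + 1) * (1 + 1 / (n * (m - n))) ≤ 1 := by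
    intro h2
    have h2' : (2 : ℝ) ≤ n := by exact_mod_cast h2
    have hd : (1 : ℝ) ≤ m - n := by linarith
    have e : ((m : ℝ) - n + 1) / (m + 1) * (1 + 1 / (n * (m - n)))
        = ((m - n + 1) * (n * (m - n) + 1)) / ((m + 1) * (n * (m - n))) := by
      field_simp
    rw [e, div_le_one (by positivity)]
    have h4 : 4 * ((m : ℝ) - n) ≤ n ^ 2 * (m - n) := by
      gcongr
      nlinarith
    nlinarith
  have hsq2 : 2 ≤ n →
      ∫ U, interference U t k s ^ 2 ∂haarUnitary m ≤ pUnif m n ^ 2 * ((n + 1) / 2) := by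
    intro h2
    refine hsq.trans ?_
    calc _ = pUnif m n ^ 2 * ((n + 1) / 2)
          * (((m : ℝ) - n + 1) / (m + 1) * (1 + 1 / (n * (m - n)))) := by ring
      _ ≤ pUnif m n ^ 2 * ((n + 1) / 2) * 1 := by
        gcongr
        exact hcoef h2
      _ = _ := mul_one _
  -- Without the mean the bound is ((n + 1)/2 + 1) p², at most n p² exactly when n ≥ 3.
  rcases Nat.lt_or_ge n 3 with h3 | h3
  · interval_cases n
    · rw [hexp, integral_interference_of_const hk hkn hnm t s (integral_idealProb_one t)]
      have hp : pUnif m 1 = 1 / m := by simp [pUnif]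
      push_cast at hsq hmn ⊢
      -- The coefficient is m²/(m² - 1) ≤ 2, and the mean equals p, so the total is at most (2 - 2 +
      -- 1) p².
      have h5 : ((m : ℝ) - 1 + 1) / (m + 1) * ((1 + 1) / 2) * (1 + 1 / (1 * (m - 1))) ≤ 2 := by
        have hd : (0 : ℝ) < m - 1 := by linarith
        have e : ((m : ℝ) - 1 + 1) / (m + 1) * ((1 + 1) / 2) * (1 + 1 / (1 * (m - 1)))
            = m ^ 2 / ((m + 1) * (m - 1)) := by
          field_simp
          ring
        rw [e, div_le_iff₀ (by positivity)]
        nlinarith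
      have h6 := mul_le_mul_of_nonneg_left h5 hp2
      rw [← hp]
      nlinarith
    · rw [hexp, integral_interference_of_const hk hkn hnm t s (integral_idealProb_two t)]
      have h4 := hsq2 le_rfl
      push_cast at h4 hmn ⊢
      have hp : pUnif m 2 = 2 / (m * (m - 1)) := by
        rw [pUnif, Nat.cast_choose_two]
        field_simp
      -- Since m ≥ 3, the mean is at least p/2, and 3/2 - 1 + 1 ≤ 2.
      have h5 : pUnif m 2 / 2 ≤ 2 / (m * (m + 1)) := by
        have hd : (0 : ℝ) < m - 1 := by linarith
        have hm : (0 : ℝ) < m := by linarith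
        rw [hp, div_div, div_le_div_iff₀ (by positivity) (by positivity)]
        nlinarith
      have hp0 : 0 ≤ pUnif m 2 := by
        unfold pUnif
        positivity
      have h6 := mul_le_mul_of_nonneg_left h5 hp0
      nlinarith
  · have h3' : (3 : ℝ) ≤ n := by exact_mod_cast h3
    have hmean : 0 ≤ 2 * pUnif m n * ∫ U, interference U t k s ∂haarUnitary m := by
      refine mul_nonneg (mul_nonneg zero_le_two (by unfold pUnif; positivity))
        (integral_nonneg fun U => ?_)
      rw [interference_eq_sum]
      exact mul_nonneg (one_div_nonneg.2 (interferenceCount_pos hk hkn hnm).le)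
        (Finset.sum_nonneg fun x _ => idealProb_nonneg U t x.2)
    have h4 := hsq2 (by omega)
    rw [hexp]
    nlinarith

end

end LinearOptics

theorem theorem1 (m n k : ℕ) (hk : 1 ≤ k) (hkn : k ≤ n) (hnm : n < m)
    (t s : LinearOptics.BitString m n) (ε : ℝ) (hε : 0 < ε) :
    (LinearOptics.haarUnitary m).real
        {U : Matrix.unitaryGroup (Fin m) ℂ |
          ε ≤ |LinearOptics.interference U t k s - LinearOptics.pUnif m n|}
      ≤ (n : ℝ) * LinearOptics.pUnif m n ^ 2 / ε ^ 2 := by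
  have hset : {U : Matrix.unitaryGroup (Fin m) ℂ |
      ε ≤ |LinearOptics.interference U t k s - LinearOptics.pUnif m n|}
      = {U | ε ^ 2 ≤ (LinearOptics.interference U t k s - LinearOptics.pUnif m n) ^ 2} := by
    ext U
    simp only [Set.mem_ofPred_eq]
    rw [← sq_abs (LinearOptics.interference U t k s - _), sq_le_sq₀ hε.le (abs_nonneg _)]
  rw [hset, le_div_iff₀ (by positivity), mul_comm]
  exact (mul_meas_ge_le_integral_of_nonneg (Filter.Eventually.of_forall fun U => sq_nonneg _)
    (LinearOptics.integrable_haarUnitary (by fun_prop)) _).trans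
    (LinearOptics.integral_interference_sub_sq_le hk hkn hnm t s)
end
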